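/- Let $H$ be a (finite, simple) bipartite graph with bipartition $(A,B)$ such that $|A|=|B|$, and let $A'\subseteq A$ and $B'\subseteq B$ with $|A'|=|B'|$. We say that $H$ is \emph{robustly matchable} with respect to $A'$ and $B'$ if for every pair of sets $X\subseteq A'$ and $Y\subseteq B'$ with $|X|=|Y|\le |A'|/2$, there is a perfect matching in $H-(X\cup Y)$. For $m\in\mathbb N$, a $2RMBG(7m,2m)$ is a bipartite graph $H$ with bipartition $(A,B)$, where $|A|=|B|=7m$, such that $H$ is robustly matchable with respect to some sets $A'\subseteq A$ and $B'\subseteq B$ with $|A'|=|B'|=2m$. Lemma. For all sufficiently large $m\in\mathbb N$, there is a $2RMBG(7m,2m)$ that is $256$-regular. -/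

import Mathlib

/-- For a graph `H` on a finite vertex type and finite sets of vertices `A'` and `B'` (contained in
the two different classes of a bipartition of `H`), `H` is robustly matchable with respect to
`A'` and `B'` if for all `X ⊆ A'` and `Y ⊆ B'` with `|X| = |Y| ≤ |A'| / 2`, the graph
`H - (X ∪ Y)` (the subgraph induced on the remaining vertices) has a perfect matching. -/
def RobustlyMatchable {V : Type*} (H : SimpleGraph V) (A' B' : Finset V) : Prop :=
  ∀ X Y : Finset V, X ⊆ A' → Y ⊆ B' → X.card = Y.card → 2 * X.card ≤ A'.card →
    ∃ M : (H.induce ((X : Set V) ∪ (Y : Set V))ᶜ).Subgraph, M.IsPerfectMatching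

/-- `H` is a `2RMBG(7m, 2m)`: it is a bipartite graph with a bipartition `(A, B)` of its vertex set,
`|A| = |B| = 7m`, which is robustly matchable with respect to some `A' ⊆ A` and `B' ⊆ B`
with `|A'| = |B'| = 2m`. -/
def IsTwoRMBG {V : Type*} (m : ℕ) (H : SimpleGraph V) : Prop :=
  ∃ A B : Finset V,
    H.IsBipartiteWith (A : Set V) (B : Set V) ∧ (A : Set V) ∪ (B : Set V) = Set.univ ∧
    A.card = 7 * m ∧ B.card = 7 * m ∧
    ∃ A' B' : Finset V, A' ⊆ A ∧ B' ⊆ B ∧ A'.card = 2 * m ∧ B'.card = 2 * m ∧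
      RobustlyMatchable H A' B'

/-! Each class is a copy of `Fin (5 * m) ⊕ Fin (2 * m)`, whose second summands are `A'` and `B'`. By
Hall's theorem it is enough that every set of up to about half a class has at least as many
neighbours in the first summand opposite, which no deletion touches.

A union bound gives 24 permutations of `Fin (5 * m)` that double every set of density at most 3/8.
Folding the second summand into the first at most halves a set, so half a class folds to density at
least about 7/20 < 3/8, and doubling part of its image recovers the loss. Joining points to images
symmetrically makes both sides expand, with degrees at most 72. Adding edges preserves expansion, so
an edge-switching argument completes the graph to a 256-regular one. -/

/-! ### Expansion by random permutations -/

open Finset in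
/-- The number of permutations mapping `U` into `W`. -/
theorem card_perm_image_subset_mul_choose {α : Type*} [Fintype α] [DecidableEq α]
    (U W : Finset α) :
    #{σ : Equiv.Perm α | U.image σ ⊆ W} * (Fintype.card α).choose #U =
      (Fintype.card α).factorial * (#W).choose #U := by
  -- Left translation by a permutation taking `U` to `V` matches the two sets.
  have fiber : ∀ V : Finset α, #V = #U →
      #{σ : Equiv.Perm α | U.image σ = V} = #{σ : Equiv.Perm α | U.image σ = U} := by
    intro V hV
    obtain ⟨τ, hτ⟩ : ∃ τ : Equiv.Perm α, U.image τ = V := by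
      let e : {x // x ∈ U} ≃ {x // x ∈ V} := Finset.equivOfCardEq hV.symm
      refine ⟨e.extendSubtype, Finset.eq_of_subset_of_card_le ?_ ?_⟩
      · intro y hy
        obtain ⟨x, hx, rfl⟩ := Finset.mem_image.1 hy
        exact e.extendSubtype_mem x hx
      · rw [Finset.card_image_of_injective _ (Equiv.injective _), hV]
    symm
    refine Finset.card_bij (fun σ _ => τ * σ) ?_ ?_ ?_
    · intro σ hσ
      simp only [mem_filter, mem_univ, true_and] at hσ ⊢
      rw [Equiv.Perm.coe_mul, ← Finset.image_image, hσ, hτ]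
    · intro σ _ σ' _ h
      exact mul_left_cancel h
    · intro σ hσ
      simp only [mem_filter, mem_univ, true_and] at hσ
      refine ⟨τ⁻¹ * σ, ?_, by simp⟩
      simp only [mem_filter, mem_univ, true_and]
      rw [Equiv.Perm.coe_mul, ← Finset.image_image, hσ, ← hτ, Finset.image_image,
        ← Equiv.Perm.coe_mul]
      simp
  have count : ∀ W : Finset α, #{σ : Equiv.Perm α | U.image σ ⊆ W} =
      (#W).choose #U * #{σ : Equiv.Perm α | U.image σ = U} := by
    intro W
    rw [Finset.card_eq_sum_card_fiberwise (f := fun σ : Equiv.Perm α => U.image σ)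
      (t := W.powersetCard #U)]
    · rw [← Finset.card_powersetCard, ← smul_eq_mul, ← Finset.sum_const]
      refine Finset.sum_congr rfl fun V hV => ?_
      rw [Finset.mem_powersetCard] at hV
      rw [← fiber V hV.2, Finset.filter_filter]
      congr 1
      ext σ
      simp only [mem_filter, mem_univ, true_and]
      exact ⟨fun h => h.2, fun h => ⟨h ▸ hV.1, h⟩⟩
    · intro σ hσ
      simp only [coe_filter, mem_univ, true_and, Set.mem_ofPred_eq] at hσ
      simp only [mem_coe, Finset.mem_powersetCard]
      exact ⟨hσ, Finset.card_image_of_injective _ σ.injective⟩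
  -- Taking `W` to be everything determines the common fibre size.
  have total := count Finset.univ
  simp only [subset_univ, filter_true, Finset.card_univ, Fintype.card_perm] at total
  rw [count W, total]
  ring

theorem Nat.choose_mul_four_pow_le {w n : ℕ} (h : 4 * w ≤ 3 * n) (k : ℕ) :
    w.choose k * 4 ^ k ≤ 3 ^ k * n.choose k := by
  have key : w.descFactorial k * 4 ^ k ≤ 3 ^ k * n.descFactorial k := by
    induction k with
    | zero => simp
    | succ k ih =>
      rw [Nat.descFactorial_succ, Nat.descFactorial_succ]
      calc (w - k) * w.descFactorial k * 4 ^ (k + 1)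
          = (4 * (w - k)) * (w.descFactorial k * 4 ^ k) := by ring
        _ ≤ (3 * (n - k)) * (3 ^ k * n.descFactorial k) :=
            Nat.mul_le_mul (by omega) ih
        _ = _ := by ring
  rw [Nat.descFactorial_eq_factorial_mul_choose, Nat.descFactorial_eq_factorial_mul_choose] at key
  refine Nat.le_of_mul_le_mul_left ?_ k.factorial_pos
  calc _ = k.factorial * w.choose k * 4 ^ k := by ring
    _ ≤ _ := key
    _ = _ := by ring

theorem Nat.choose_two_mul_le_sq (n u : ℕ) : n.choose (2 * u) ≤ n.choose u ^ 2 := by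
  have h := Nat.choose_mul (n := n) (k := 2 * u) (s := u) (by omega)
  have hpos : 0 < (2 * u).choose u := Nat.choose_pos (by omega)
  calc n.choose (2 * u) ≤ n.choose (2 * u) * (2 * u).choose u := Nat.le_mul_of_pos_right _ hpos
    _ = n.choose u * (n - u).choose (2 * u - u) := h
    _ ≤ n.choose u * n.choose u := by
        refine Nat.mul_le_mul le_rfl ?_
        rw [show 2 * u - u = u by omega]
        exact Nat.choose_le_choose u (Nat.sub_le n u)
    _ = _ := by ring

/-- Union bound for fixed `u`: the choices of a set and a target of size `2 * u`, times the
probability that 24 independent permutations all map the set into the target. -/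
theorem choose_mul_choose_mul_ratio_pow_le {n u : ℕ} (h : 8 * u ≤ 3 * n) :
    (n.choose u * n.choose (2 * u) : ℚ) * (((2 * u).choose u : ℚ) / n.choose u) ^ 24 ≤
      (1 / 4) ^ u := by
  have hC : (0 : ℚ) < n.choose u := by exact_mod_cast Nat.choose_pos (by omega)
  set c : ℚ := (n.choose u : ℚ) with hc
  set b : ℚ := ((2 * u).choose u : ℚ) with hb
  have hb0 : 0 ≤ b := by positivity
  have h1 : (n.choose (2 * u) : ℚ) ≤ c ^ 2 := by
    rw [hc]
    exact_mod_cast Nat.choose_two_mul_le_sq n u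
  have h2 : b ≤ 4 ^ u := by
    have := Nat.centralBinom_le_four_pow u
    rw [Nat.centralBinom_eq_two_mul_choose] at this
    rw [hb]
    exact_mod_cast this
  have h3 : b / c ≤ (3 / 4) ^ u := by
    have : b * 4 ^ u ≤ 3 ^ u * c := by
      rw [hb, hc]
      exact_mod_cast Nat.choose_mul_four_pow_le (w := 2 * u) (n := n) (by omega) u
    rw [div_pow, div_le_div_iff₀ hC (by positivity)]
    exact this
  -- Three of the 24 factors cancel `c ^ 3`; the other 21 suffice because 64 · (3/4)^21 < 1/4.
  calc c * (n.choose (2 * u)) * (b / c) ^ 24 ≤ c * c ^ 2 * (b / c) ^ 24 := by gcongr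
    _ = b ^ 3 * (b / c) ^ 21 := by field_simp
    _ ≤ (4 ^ u) ^ 3 * ((3 / 4) ^ u) ^ 21 := by gcongr
    _ = (4 ^ 3 * (3 / 4) ^ 21) ^ u := by
        rw [mul_pow, pow_right_comm 4 u 3, pow_right_comm (3 / 4) u 21]
    _ ≤ (1 / 4) ^ u := by
        gcongr
        norm_num

open Finset in
/-- Some 24 permutations expand every set of density at most `3/8` by a factor of two. -/
theorem exists_perms_two_mul_card_le_card_biUnion (n : ℕ) :
    ∃ σ : Fin 24 → Equiv.Perm (Fin n), ∀ U : Finset (Fin n), 8 * #U ≤ 3 * n →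
      2 * #U ≤ #(U.biUnion fun x => univ.image fun i => σ i x) := by
  by_contra! hcon
  let bad (U W : Finset (Fin n)) : Finset (Fin 24 → Equiv.Perm (Fin n)) :=
    Fintype.piFinset fun _ => {τ : Equiv.Perm (Fin n) | U.image τ ⊆ W}
  let I : Finset ℕ := {u ∈ Icc 1 n | 8 * u ≤ 3 * n}
  have cover : (univ : Finset (Fin 24 → Equiv.Perm (Fin n))) ⊆
      I.biUnion fun u => (univ.powersetCard u).biUnion fun U =>
        (univ.powersetCard (2 * u)).biUnion fun W => bad U W := by
    intro σ _
    obtain ⟨U, hU, hlt⟩ := hcon σ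
    obtain ⟨W, hW, hWcard⟩ := Finset.exists_superset_card_eq hlt.le (by
      rw [Fintype.card_fin]; omega)
    simp only [mem_biUnion, mem_powersetCard, subset_univ, true_and]
    refine ⟨#U, ?_, U, rfl, W, hWcard, ?_⟩
    · simp only [I, mem_filter, mem_Icc]
      omega
    · simp only [bad, Fintype.mem_piFinset, mem_filter, mem_univ, true_and]
      intro i y hy
      obtain ⟨x, hx, rfl⟩ := Finset.mem_image.1 hy
      exact hW (mem_biUnion.2 ⟨x, hx, mem_image_of_mem _ (mem_univ i)⟩)
  have hbad : ∀ u ∈ I, ∀ U ∈ (univ : Finset (Fin n)).powersetCard u,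
      ∀ W ∈ (univ : Finset (Fin n)).powersetCard (2 * u),
      (#(bad U W) : ℚ) = (n.factorial : ℚ) ^ 24 * (((2 * u).choose u : ℚ) / n.choose u) ^ 24 := by
    intro u hu U hU W hW
    simp only [I, mem_filter, mem_Icc] at hu
    simp only [mem_powersetCard, subset_univ, true_and] at hU hW
    have hpos : (0 : ℚ) < n.choose u := by exact_mod_cast Nat.choose_pos hu.1.2
    have := card_perm_image_subset_mul_choose U W
    rw [hU, hW, Fintype.card_fin] at this
    have hq : (#{τ : Equiv.Perm (Fin n) | U.image τ ⊆ W} : ℚ) * n.choose u =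
        n.factorial * (2 * u).choose u := by exact_mod_cast this
    rw [Fintype.card_piFinset_const, ← mul_pow, Nat.cast_pow]
    congr 1
    rw [← mul_div_assoc, eq_div_iff hpos.ne', hq]
  have hfac : (0 : ℚ) < (n.factorial : ℚ) ^ 24 := by positivity
  have hle : ((n.factorial : ℚ) ^ 24) ≤ ∑ u ∈ I, (n.factorial : ℚ) ^ 24 * (1 / 4) ^ u := by
    calc ((n.factorial : ℚ) ^ 24)
        = (#(univ : Finset (Fin 24 → Equiv.Perm (Fin n))) : ℚ) := by
          simp [Fintype.card_perm]
      _ ≤ (#(I.biUnion fun u => (univ.powersetCard u).biUnion fun U =>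
          (univ.powersetCard (2 * u)).biUnion fun W => bad U W) : ℚ) := by
          exact_mod_cast Finset.card_le_card cover
      _ ≤ ∑ u ∈ I, ∑ U ∈ (univ : Finset (Fin n)).powersetCard u,
          ∑ W ∈ (univ : Finset (Fin n)).powersetCard (2 * u), (#(bad U W) : ℚ) := by
          exact_mod_cast card_biUnion_le.trans (sum_le_sum fun u _ =>
            card_biUnion_le.trans (sum_le_sum fun U _ => card_biUnion_le))
      _ ≤ _ := by
          refine sum_le_sum fun u hu => ?_
          rw [sum_congr rfl fun U hU => sum_congr rfl fun W hW => hbad u hu U hU W hW]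
          simp only [sum_const, card_powersetCard, card_univ, Fintype.card_fin, nsmul_eq_mul]
          have := choose_mul_choose_mul_ratio_pow_le (n := n) (u := u) (by simp [I] at hu; omega)
          calc _ = (n.factorial : ℚ) ^ 24 * ((n.choose u * n.choose (2 * u) : ℚ) *
                (((2 * u).choose u : ℚ) / n.choose u) ^ 24) := by ring
            _ ≤ _ := by gcongr
  have geom : ∀ k : ℕ, ∑ u ∈ Icc 1 k, (1 / 4 : ℚ) ^ u ≤ 1 / 3 - 1 / 3 * (1 / 4) ^ k := by
    intro k
    induction k with
    | zero => simp
    | succ k ih =>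
      rw [Finset.sum_Icc_succ_top (by omega), pow_succ]
      linarith
  have hsum : ∑ u ∈ I, (1 / 4 : ℚ) ^ u < 1 := by
    calc _ ≤ ∑ u ∈ Icc 1 n, (1 / 4 : ℚ) ^ u :=
          sum_le_sum_of_subset_of_nonneg (filter_subset _ _) fun _ _ _ => by positivity
      _ ≤ _ := geom n
      _ < 1 := by
        have : (0 : ℚ) < (1 / 4) ^ n := by positivity
        linarith
  rw [← mul_sum] at hle
  nlinarith

/-! ### Completion to a regular bipartite graph -/

open Finset in
theorem card_eq_sum_card_row {α β : Type*} [Fintype α] [Fintype β] [DecidableEq α]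
    [DecidableEq β] (E : Finset (α × β)) : #E = ∑ a, #{b | (a, b) ∈ E} := by
  simp only [card_filter]
  rw [← Fintype.sum_prod_type' (f := fun a b => if (a, b) ∈ E then 1 else 0)]
  simp

open Finset in
theorem card_eq_sum_card_column {α β : Type*} [Fintype α] [Fintype β] [DecidableEq α]
    [DecidableEq β] (E : Finset (α × β)) : #E = ∑ b, #{a | (a, b) ∈ E} := by
  simp only [card_filter]
  rw [← Fintype.sum_prod_type_right' (f := fun a b => if (a, b) ∈ E then 1 else 0)]
  simp

open Finset in
/-- A balanced bipartite graph (given by its edges) of small maximum degree is contained in a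
`d`-regular one. -/
theorem exists_regular_superset {α β : Type*} [Fintype α] [Fintype β] [DecidableEq α]
    [DecidableEq β] (hcard : Fintype.card α = Fintype.card β) (E₀ : Finset (α × β)) {d₀ d : ℕ}
    (hd : d₀ ≤ d) (hrow : ∀ a, #{b | (a, b) ∈ E₀} ≤ d₀) (hcol : ∀ b, #{a | (a, b) ∈ E₀} ≤ d₀)
    (hbig : d₀ * Fintype.card α + 3 * (d * d) < d * Fintype.card α) :
    ∃ E : Finset (α × β), E₀ ⊆ E ∧ (∀ a, #{b | (a, b) ∈ E} = d) ∧
      ∀ b, #{a | (a, b) ∈ E} = d := by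
  obtain ⟨E, hE, hmax⟩ := Finset.exists_max_image
    ({E | E₀ ⊆ E ∧ (∀ a, #{b | (a, b) ∈ E} ≤ d) ∧ ∀ b, #{a | (a, b) ∈ E} ≤ d} :
      Finset (Finset (α × β))) card
    ⟨E₀, by simpa using ⟨fun a => (hrow a).trans hd, fun b => (hcol b).trans hd⟩⟩
  simp only [mem_filter, mem_univ, true_and] at hE hmax
  obtain ⟨hsub, hr, hc⟩ := hE
  have hrowsum := card_eq_sum_card_row E
  have hcolsum := card_eq_sum_card_column E
  have hconstα : ∑ _a : α, d = d * Fintype.card α := by simp [mul_comm]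
  have hconstβ : ∑ _b : β, d = d * Fintype.card α := by simp [mul_comm, hcard]
  suffices hall : ∀ a, #{b | (a, b) ∈ E} = d by
    refine ⟨E, hsub, hall, fun b => ?_⟩
    refine (Finset.sum_eq_sum_iff_of_le fun b _ => hc b).1 ?_ b (mem_univ b)
    rw [← hcolsum, hrowsum, hconstβ, ← hconstα]
    exact sum_congr rfl fun a _ => hall a
  by_contra! hne
  obtain ⟨a, ha⟩ := hne
  have ha : #{b | (a, b) ∈ E} < d := lt_of_le_of_ne (hr a) ha
  have hlt : #E < d * Fintype.card α := by
    rw [hrowsum, ← hconstα]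
    exact sum_lt_sum (fun x _ => hr x) ⟨a, mem_univ a, ha⟩
  obtain ⟨b, hb⟩ : ∃ b, #{x | (x, b) ∈ E} < d := by
    by_contra! h
    refine hlt.not_ge ?_
    rw [hcolsum, ← hconstβ]
    exact sum_le_sum fun y _ => h y
  -- Otherwise the edge could be added, against maximality. Hence all deficient rows are neighbours
  -- of `b`, so at most `d * d` edges are missing.
  have hadj : ∀ x y, #{z | (x, z) ∈ E} < d → #{z | (z, y) ∈ E} < d → (x, y) ∈ E := by
    intro x y hx hy
    by_contra hxy
    have := hmax (insert (x, y) E) ⟨hsub.trans (subset_insert _ _), fun x' => ?_, fun y' => ?_⟩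
    · rw [card_insert_of_notMem hxy] at this
      omega
    · by_cases h : x' = x
      · subst h
        have : ({z | (x', z) ∈ insert (x', y) E} : Finset β) ⊆
            insert y ({z | (x', z) ∈ E} : Finset β) := by
          intro z; simp
        exact (card_le_card this).trans ((card_insert_le _ _).trans hx)
      · simpa [h] using hr x'
    · by_cases h : y' = y
      · subst h
        have : ({z | (z, y') ∈ insert (x, y') E} : Finset α) ⊆
            insert x ({z | (z, y') ∈ E} : Finset α) := by
          intro z; simp
        exact (card_le_card this).trans ((card_insert_le _ _).trans hy)
      · simpa [h] using hc y'
  have hmany : d * Fintype.card α ≤ #E + d * d := by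
    calc d * Fintype.card α = ∑ _x : α, d := hconstα.symm
      _ ≤ ∑ x, (#{z | (x, z) ∈ E} + if (x, b) ∈ E then d else 0) := by
          refine sum_le_sum fun x _ => ?_
          split_ifs with h
          · omega
          · by_contra! h'
            exact h (hadj x b (by omega) hb)
      _ = #E + #{x | (x, b) ∈ E} * d := by
          rw [sum_add_distrib, ← hrowsum, ← sum_filter, sum_const, smul_eq_mul]
      _ ≤ _ := by gcongr
  have hE₀ : #E₀ ≤ d₀ * Fintype.card α := by
    rw [card_eq_sum_card_row E₀]
    calc _ ≤ ∑ _x : α, d₀ := sum_le_sum fun x _ => hrow x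
      _ = _ := by simp [mul_comm]
  -- Edges in `E₀`, or meeting a neighbour of `a` or of `b`, number at most `#E₀ + 2 * (d * d)`,
  -- fewer than `#E` by `hbig`.
  obtain ⟨⟨a', b'⟩, he, he₀, hab', ha'b⟩ :
      ∃ e ∈ E, e ∉ E₀ ∧ (a, e.2) ∉ E ∧ (e.1, b) ∉ E := by
    by_contra! h
    have hcover : E ⊆ E₀ ∪ (({y | (a, y) ∈ E} : Finset β).biUnion fun y =>
          ({x | (x, y) ∈ E} : Finset α).image fun x => (x, y)) ∪
        (({x | (x, b) ∈ E} : Finset α).biUnion fun x =>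
          ({y | (x, y) ∈ E} : Finset β).image fun y => (x, y)) := by
      rintro ⟨x, y⟩ hxy
      have := h _ hxy
      simp only [mem_union, mem_biUnion, mem_image, mem_filter, mem_univ, true_and,
        Prod.mk.injEq]
      by_cases h1 : (x, y) ∈ E₀
      · exact Or.inl (Or.inl h1)
      by_cases h2 : (a, y) ∈ E
      · exact Or.inl (Or.inr ⟨y, h2, x, hxy, rfl, rfl⟩)
      · exact Or.inr ⟨x, this h1 h2, y, hxy, rfl, rfl⟩
    have h1 := (card_le_card hcover).trans ((card_union_le _ _).trans
      (Nat.add_le_add_right (card_union_le _ _) _))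
    have h2 := card_biUnion_le_card_mul ({y | (a, y) ∈ E} : Finset β) (fun y =>
          ({x | (x, y) ∈ E} : Finset α).image fun x => (x, y)) d
          fun y _ => card_image_le.trans (hc y)
    have h3 := card_biUnion_le_card_mul ({x | (x, b) ∈ E} : Finset α) (fun x =>
          ({y | (x, y) ∈ E} : Finset β).image fun y => (x, y)) d
          fun x _ => card_image_le.trans (hr x)
    have h4 := Nat.mul_le_mul_right d (hr a)
    have h5 := Nat.mul_le_mul_right d (hc b)
    omega
  have haa' : a' ≠ a := by
    rintro rfl
    exact hab' he
  have hbb' : b' ≠ b := by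
    rintro rfl
    exact ha'b he
  -- The switch keeps the degrees of `a'` and `b'`, raises those of `a` and `b`, and gains one edge.
  have := hmax (insert (a, b') (insert (a', b) (E.erase (a', b'))))
    ⟨fun e h => ?_, fun x => ?_, fun y => ?_⟩
  · rw [card_insert_of_notMem (by simp [hab', haa'.symm]),
      card_insert_of_notMem (by simp [ha'b]), card_erase_of_mem he] at this
    have := card_pos.2 ⟨_, he⟩
    omega
  · exact mem_insert_of_mem (mem_insert_of_mem
      (mem_erase.2 ⟨fun h' => he₀ (h' ▸ h), hsub h⟩))
  · by_cases hx : x = a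
    · subst hx
      refine (card_le_card (t := insert b' ({z | (x, z) ∈ E} : Finset β)) ?_).trans
        ((card_insert_le _ _).trans ha)
      intro z
      simp [haa'.symm]
    by_cases hx' : x = a'
    · subst hx'
      refine (card_le_card (t := insert b (({z | (x, z) ∈ E} : Finset β).erase b')) ?_).trans
        ((card_insert_le _ _).trans ?_)
      · intro z
        simp [hx]
      · rw [card_erase_add_one (by simpa using he)]
        exact hr x
    · refine (card_le_card ?_).trans (hr x)
      intro z
      simp [hx, hx']
  · by_cases hy : y = b
    · subst hy
      refine (card_le_card (t := insert a' ({z | (z, y) ∈ E} : Finset α)) ?_).trans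
        ((card_insert_le _ _).trans hb)
      intro z
      simp [hbb'.symm]
    by_cases hy' : y = b'
    · subst hy'
      refine (card_le_card (t := insert a (({z | (z, y) ∈ E} : Finset α).erase a')) ?_).trans
        ((card_insert_le _ _).trans ?_)
      · intro z
        simp [hy]
      · rw [card_erase_add_one (by simpa using he)]
        exact hc y
    · refine (card_le_card ?_).trans (hc y)
      intro z
      simp [hy, hy']

/-! ### From expansion to robust matchability -/

open Finset in
/-- If all sets of at most about half of either class expand outside `A'` and `B'`, then deleting
subsets of `A'` and `B'` of equal size preserves Hall's condition. -/
theorem robustlyMatchable_of_expansion {V : Type*} [DecidableEq V] (H : SimpleGraph V)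
    [DecidableRel H.Adj] {A B A' B' : Finset V} (hdisj : Disjoint A B)
    (huniv : (A : Set V) ∪ (B : Set V) = Set.univ) (hcard : #A = #B) (hA' : A' ⊆ A) (hB' : B' ⊆ B)
    (hA : ∀ S ⊆ A, 2 * #S ≤ #A + 2 → #S ≤ #{b ∈ B \ B' | ∃ a ∈ S, H.Adj a b})
    (hB : ∀ S ⊆ B, 2 * #S ≤ #B + 2 → #S ≤ #{a ∈ A \ A' | ∃ b ∈ S, H.Adj a b}) :
    RobustlyMatchable H A' B' := by
  intro X Y hX hY hXY _
  have hP : #(A \ X) + #X = #A := card_sdiff_add_card_eq_card (hX.trans hA')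
  have hQ : #(B \ Y) + #Y = #B := card_sdiff_add_card_eq_card (hY.trans hB')
  have hall : ∀ S ⊆ A \ X, #S ≤ #{b ∈ B \ Y | ∃ a ∈ S, H.Adj a b} := by
    intro S hS
    by_contra! hlt
    set N : Finset V := {b ∈ B \ Y | ∃ a ∈ S, H.Adj a b} with hN
    have hSlarge : #A + 2 < 2 * #S := by
      by_contra! h
      refine hlt.not_ge ((hA S (hS.trans sdiff_subset) h).trans (card_le_card ?_))
      exact filter_subset_filter _ (sdiff_subset_sdiff le_rfl hY)
    have hSP := card_le_card hS
    have hT : #((B \ Y) \ N) + #N = #(B \ Y) := card_sdiff_add_card_eq_card (filter_subset _ _)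
    -- Since `S` is large, a set `T` of one more element than its complement is still small, and it
    -- fits among the non-neighbours of `S`. Its neighbours must avoid `S`, which contradicts
    -- expansion.
    obtain ⟨T, hTsub, hTcard⟩ := exists_subset_card_eq
      (show #(A \ X) - #S + 1 ≤ #((B \ Y) \ N) by omega)
    have hTexp := hB T (hTsub.trans (sdiff_subset.trans sdiff_subset)) (by omega)
    have hsub : ({a ∈ A \ A' | ∃ b ∈ T, H.Adj a b} : Finset V) ⊆ (A \ X) \ S := by
      intro a ha
      rw [mem_filter, mem_sdiff] at ha
      obtain ⟨⟨haA, haA'⟩, b, hb, hab⟩ := ha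
      refine mem_sdiff.2 ⟨mem_sdiff.2 ⟨haA, fun h => haA' (hX h)⟩, fun haS => ?_⟩
      have hb' := mem_sdiff.1 (hTsub hb)
      exact hb'.2 (mem_filter.2 ⟨hb'.1, a, haS, hab⟩)
    have h1 := card_le_card hsub
    have h2 : #((A \ X) \ S) + #S = #(A \ X) := card_sdiff_add_card_eq_card hS
    omega
  obtain ⟨f, hinj, hf⟩ := (Finset.all_card_le_biUnion_card_iff_exists_injective
    (fun a : {a // a ∈ A \ X} => ({b ∈ B \ Y | H.Adj a b} : Finset V))).1 fun S => by
      have h := hall (S.map (Function.Embedding.subtype _)) fun a ha => by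
        obtain ⟨x, _, rfl⟩ := mem_map.1 ha
        exact x.2
      rw [card_map] at h
      refine h.trans (card_le_card fun b hb => ?_)
      simp only [mem_filter, mem_map, Function.Embedding.subtype_apply] at hb
      obtain ⟨hb, _, ⟨x, hx, rfl⟩, hab⟩ := hb
      exact mem_biUnion.2 ⟨x, hx, mem_filter.2 ⟨hb, hab⟩⟩
  have hfimage : ∀ b ∈ B \ Y, ∃ a, f a = b := by
    have himage : univ.image f = B \ Y := by
      refine eq_of_subset_of_card_le (fun b hb => ?_) ?_
      · obtain ⟨a, _, rfl⟩ := mem_image.1 hb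
        exact (mem_filter.1 (hf a)).1
      · rw [card_image_of_injective _ hinj, card_univ, Fintype.card_coe]
        omega
    intro b hb
    rw [← himage] at hb
    obtain ⟨a, _, h⟩ := mem_image.1 hb
    exact ⟨a, h⟩
  let W : Set V := ((X : Set V) ∪ (Y : Set V))ᶜ
  have memA : ∀ v, v ∈ A \ X → v ∈ W := by
    intro v hv h
    rw [mem_sdiff] at hv
    rcases h with h | h
    · exact hv.2 h
    · exact (disjoint_left.1 hdisj hv.1) (hB' (hY h))
  have memB : ∀ v, v ∈ B \ Y → v ∈ W := by
    intro v hv h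
    rw [mem_sdiff] at hv
    rcases h with h | h
    · exact (disjoint_right.1 hdisj hv.1) (hA' (hX h))
    · exact hv.2 h
  let s : Set W := {v | (v : V) ∈ A \ X}
  let t : Set W := {v | (v : V) ∈ B \ Y}
  have hst : Disjoint s t := by
    rw [Set.disjoint_left]
    intro v hv hv'
    exact disjoint_left.1 hdisj (mem_sdiff.1 hv).1 (mem_sdiff.1 hv').1
  let g : s → t := fun v => ⟨⟨f ⟨v.1.1, v.2⟩, memB _ (mem_filter.1 (hf _)).1⟩,
    (mem_filter.1 (hf _)).1⟩
  have hg : Function.Bijective g := by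
    constructor
    · intro v w h
      have h' : f ⟨v.1.1, v.2⟩ = f ⟨w.1.1, w.2⟩ := congrArg (fun z : t => z.1.1) h
      exact Subtype.ext (Subtype.ext (congrArg (fun z : {a // a ∈ A \ X} => z.1) (hinj h')))
    · intro w
      obtain ⟨a, ha⟩ := hfimage w.1.1 w.2
      exact ⟨⟨⟨a.1, memA _ a.2⟩, a.2⟩, Subtype.ext (Subtype.ext ha)⟩
  obtain ⟨M, hM, hmatch⟩ := SimpleGraph.Subgraph.IsMatching.exists_of_disjoint_sets_of_equiv
    (G := H.induce W) hst (Equiv.ofBijective g hg)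
    fun v => (mem_filter.1 (hf ⟨v.1.1, v.2⟩)).2
  refine ⟨M, hmatch, fun v => ?_⟩
  rw [hM]
  have hv : (v : V) ∈ (A : Set V) ∪ (B : Set V) := huniv ▸ Set.mem_univ _
  have hvW : (v : V) ∉ (X : Set V) ∪ (Y : Set V) := v.2
  rcases hv with h | h
  · exact Or.inl (mem_sdiff.2 ⟨h, fun h' => hvW (Or.inl h')⟩)
  · exact Or.inr (mem_sdiff.2 ⟨h, fun h' => hvW (Or.inr h')⟩)

/-! ### The folded expander and its parameters -/

/-- The bipartite graph on `α ⊕ β` whose edges are given by a relation. -/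
def bipartiteGraphOfRel {α β : Type*} (R : α → β → Prop) : SimpleGraph (α ⊕ β) where
  Adj
    | .inl a, .inr b => R a b
    | .inr b, .inl a => R a b
    | _, _ => False
  symm := ⟨by rintro (a | b) (a' | b') h <;> exact h⟩
  loopless := ⟨by rintro (a | b) h <;> exact h⟩

/-- The projection of `Fin n ⊕ Fin k` onto `Fin n` that folds the second summand into the first. -/
def foldSum {n k : ℕ} (hk : k ≤ n) : Fin n ⊕ Fin k → Fin n :=
  Sum.elim id (Fin.castLE hk)

open Finset in
theorem card_foldSum_fiber_le {n k : ℕ} (hk : k ≤ n) (z : Fin n) :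
    #{a | foldSum hk a = z} ≤ 2 := by
  classical
  have : ({a | foldSum hk a = z} : Finset (Fin n ⊕ Fin k)) ⊆
      {Sum.inl z} ∪ ({y | Fin.castLE hk y = z} : Finset (Fin k)).image Sum.inr := by
    intro a ha
    have ha := (mem_filter.1 ha).2
    rcases a with a | a <;> simpa [foldSum] using ha
  refine (card_le_card this).trans ((card_union_le _ _).trans ?_)
  have h1 : #({y | Fin.castLE hk y = z} : Finset (Fin k)) ≤ 1 := by
    refine card_le_one.2 fun x hx y hy => ?_
    rw [mem_filter] at hx hy
    exact Fin.castLE_injective hk (hx.2.trans hy.2.symm)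
  have h2 := card_image_le (s := ({y | Fin.castLE hk y = z} : Finset (Fin k)))
    (f := (Sum.inr : Fin k → Fin n ⊕ Fin k))
  rw [card_singleton]
  omega

/-- The symmetric relation on `Fin n ⊕ Fin k` joining every element, through its fold, to its
images in `Fin n` under the permutations `σ i`. -/
def foldRel {n k r : ℕ} (hk : k ≤ n) (σ : Fin r → Equiv.Perm (Fin n)) (a b : Fin n ⊕ Fin k) :
    Prop :=
  (∃ i, b = Sum.inl (σ i (foldSum hk a))) ∨ ∃ i, a = Sum.inl (σ i (foldSum hk b))

theorem foldRel_comm {n k r : ℕ} (hk : k ≤ n) (σ : Fin r → Equiv.Perm (Fin n))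
    (a b : Fin n ⊕ Fin k) : foldRel hk σ a b ↔ foldRel hk σ b a :=
  or_comm

-- Forward edges contribute at most `r`; each permutation contributes at most two backward ones, as
-- it fixes the fold of `b`.
open Finset in
open scoped Classical in
theorem card_foldRel_le {n k r : ℕ} (hk : k ≤ n) (σ : Fin r → Equiv.Perm (Fin n))
    (a : Fin n ⊕ Fin k) : #{b | foldRel hk σ a b} ≤ 3 * r := by
  have hcover : ({b | foldRel hk σ a b} : Finset (Fin n ⊕ Fin k)) ⊆
      (univ.image fun i => Sum.inl (σ i (foldSum hk a))) ∪
        univ.biUnion fun i => {b | a = Sum.inl (σ i (foldSum hk b))} := by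
    intro b hb
    simp only [mem_filter, mem_univ, true_and] at hb
    rcases hb with ⟨i, hi⟩ | ⟨i, hi⟩
    · exact mem_union_left _ (mem_image.2 ⟨i, mem_univ i, hi.symm⟩)
    · exact mem_union_right _ (mem_biUnion.2 ⟨i, mem_univ i, by simpa using hi⟩)
  have h1 : #(univ.image fun i => (Sum.inl (σ i (foldSum hk a)) : Fin n ⊕ Fin k)) ≤ r :=
    card_image_le.trans (by simp)
  have h2 : #(univ.biUnion fun i => ({b | a = Sum.inl (σ i (foldSum hk b))} :
      Finset (Fin n ⊕ Fin k))) ≤ r * 2 := by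
    refine (card_biUnion_le_card_mul _ _ 2 fun i _ => ?_).trans (by simp)
    rcases a with x | y
    · refine (card_le_card fun b hb => ?_).trans (card_foldSum_fiber_le hk ((σ i).symm x))
      simp only [mem_filter, mem_univ, true_and, Sum.inl.injEq] at hb ⊢
      rw [hb, Equiv.symm_apply_apply]
    · simp
  have := (card_le_card hcover).trans (card_union_le _ _)
  omega

open Finset in
open scoped Classical in
/-- If the permutations expand sets of density at most `3/8` by a factor of two, then sets of about
half the size expand in `foldRel`, even when only neighbours in the first summand are counted. -/
theorem card_le_card_foldRel {m : ℕ} (hm : 8 ≤ m) (hk : 2 * m ≤ 5 * m) {r : ℕ}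
    {σ : Fin r → Equiv.Perm (Fin (5 * m))}
    (hσ : ∀ U : Finset (Fin (5 * m)), 8 * #U ≤ 3 * (5 * m) →
      2 * #U ≤ #(U.biUnion fun x => univ.image fun i => σ i x))
    (S : Finset (Fin (5 * m) ⊕ Fin (2 * m))) (hS : 2 * #S ≤ 7 * m + 2) :
    #S ≤ #{y : Fin (5 * m) | ∃ a ∈ S, foldRel hk σ a (Sum.inl y)} := by
  have himage : #S ≤ 2 * #(S.image (foldSum hk)) :=
    card_le_mul_card_image S 2 fun z _ =>
      (card_le_card (filter_subset_filter _ (subset_univ S))).trans (card_foldSum_fiber_le hk z)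
  -- Rounding up gives `#S ≤ 2 * #U`; the density condition follows from `8 * #U ≤ 14 * m + 8 ≤ 15 *
  -- m`, which needs `8 ≤ m`.
  obtain ⟨U, hU, hUcard⟩ := exists_subset_card_eq
    (show (#S + 1) / 2 ≤ #(S.image (foldSum hk)) by omega)
  refine (show #S ≤ 2 * #U by omega).trans ((hσ U (by omega)).trans (card_le_card ?_))
  intro y hy
  simp only [mem_biUnion, mem_image, mem_univ, true_and] at hy
  obtain ⟨z, hz, i, rfl⟩ := hy
  obtain ⟨a, ha, rfl⟩ := mem_image.1 (hU hz)
  simp only [mem_filter, mem_univ, true_and]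
  exact ⟨a, ha, Or.inl ⟨i, rfl⟩⟩

open Finset in
open scoped Classical in
theorem bipartiteGraphOfRel_isRegularOfDegree {α β : Type*} [Fintype α] [Fintype β]
    {R : α → β → Prop} {d : ℕ} (hr : ∀ a, #{b | R a b} = d) (hc : ∀ b, #{a | R a b} = d) :
    (bipartiteGraphOfRel R).IsRegularOfDegree d := by
  rintro (a | b)
  · rw [← hr a, ← SimpleGraph.card_neighborFinset_eq_degree,
      ← card_map (Function.Embedding.inr : β ↪ α ⊕ β)]
    congr 1
    ext (x | y) <;> rw [SimpleGraph.mem_neighborFinset] <;> simp [bipartiteGraphOfRel]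
  · rw [← hc b, ← SimpleGraph.card_neighborFinset_eq_degree,
      ← card_map (Function.Embedding.inl : α ↪ α ⊕ β)]
    congr 1
    ext (x | y) <;> rw [SimpleGraph.mem_neighborFinset] <;> simp [bipartiteGraphOfRel]

open Finset in
open scoped Classical in
/-- A relation on `Fin (5 * m) ⊕ Fin (2 * m)` in which sets of about half the size expand into the
first summand, from both sides, gives a `2RMBG(7m, 2m)`. -/
theorem isTwoRMBG_of_expansion {m : ℕ}
    {R : Fin (5 * m) ⊕ Fin (2 * m) → Fin (5 * m) ⊕ Fin (2 * m) → Prop}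
    (h₁ : ∀ S : Finset (Fin (5 * m) ⊕ Fin (2 * m)), 2 * #S ≤ 7 * m + 2 →
      #S ≤ #{y : Fin (5 * m) | ∃ a ∈ S, R a (Sum.inl y)})
    (h₂ : ∀ S : Finset (Fin (5 * m) ⊕ Fin (2 * m)), 2 * #S ≤ 7 * m + 2 →
      #S ≤ #{y : Fin (5 * m) | ∃ b ∈ S, R (Sum.inl y) b}) :
    IsTwoRMBG m (bipartiteGraphOfRel R) := by
  let L := Fin (5 * m) ⊕ Fin (2 * m)
  have hL : Fintype.card L = 7 * m := by
    simp only [L, Fintype.card_sum, Fintype.card_fin]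
    ring
  let A : Finset (L ⊕ L) := univ.map Function.Embedding.inl
  let B : Finset (L ⊕ L) := univ.map Function.Embedding.inr
  let A' : Finset (L ⊕ L) :=
    (univ.map (Function.Embedding.inr : Fin (2 * m) ↪ L)).map Function.Embedding.inl
  let B' : Finset (L ⊕ L) :=
    (univ.map (Function.Embedding.inr : Fin (2 * m) ↪ L)).map Function.Embedding.inr
  have hdisj : Disjoint A B := by
    rw [disjoint_left]
    rintro (a | b) <;> simp [A, B]
  have huniv : (A : Set (L ⊕ L)) ∪ (B : Set (L ⊕ L)) = Set.univ := by
    ext (a | b) <;> simp [A, B]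
  have hA : #A = 7 * m := by rw [card_map, card_univ, hL]
  have hB : #B = 7 * m := by rw [card_map, card_univ, hL]
  have hA'A : A' ⊆ A := map_subset_map.2 (subset_univ _)
  have hB'B : B' ⊆ B := map_subset_map.2 (subset_univ _)
  refine ⟨A, B, ⟨disjoint_coe.2 hdisj, ?_⟩, huniv, hA, hB, A', B', hA'A, hB'B, by simp [A'],
    by simp [B'], robustlyMatchable_of_expansion _ hdisj huniv (hA.trans hB.symm) hA'A hB'B
      (fun S hS hcard => ?_) fun S hS hcard => ?_⟩
  · rintro (a | a) (b | b) h <;> simp_all [A, B, bipartiteGraphOfRel]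
  · obtain ⟨S, -, rfl⟩ := subset_map_iff.1 hS
    rw [card_map] at hcard ⊢
    refine (h₁ S (by omega)).trans ?_
    rw [← card_map ((Function.Embedding.inl : Fin (5 * m) ↪ L).trans
      (Function.Embedding.inr : L ↪ L ⊕ L))]
    refine card_le_card fun v hv => ?_
    simp only [mem_map, mem_filter, mem_univ, true_and] at hv
    obtain ⟨y, ⟨a, ha, hay⟩, rfl⟩ := hv
    simp only [mem_filter, mem_sdiff]
    exact ⟨⟨by simp [B], by
      simp only [B', mem_map]
      rintro ⟨_, ⟨x, _, rfl⟩, h⟩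
      cases h⟩, Sum.inl a, by simpa using ha, hay⟩
  · obtain ⟨S, -, rfl⟩ := subset_map_iff.1 hS
    rw [card_map] at hcard ⊢
    refine (h₂ S (by omega)).trans ?_
    rw [← card_map ((Function.Embedding.inl : Fin (5 * m) ↪ L).trans
      (Function.Embedding.inl : L ↪ L ⊕ L))]
    refine card_le_card fun v hv => ?_
    simp only [mem_map, mem_filter, mem_univ, true_and] at hv
    obtain ⟨y, ⟨b, hb, hyb⟩, rfl⟩ := hv
    simp only [mem_filter, mem_sdiff]
    exact ⟨⟨by simp [A], by
      simp only [A', mem_map]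
      rintro ⟨_, ⟨x, _, rfl⟩, h⟩
      cases h⟩, Sum.inr b, by simpa using hb, hyb⟩

open Finset in
theorem mainTheorem8 :
    ∃ m₀ : ℕ, ∀ m : ℕ, m₀ ≤ m →
      ∃ (V : Type) (_ : Fintype V) (H : SimpleGraph V) (_ : DecidableRel H.Adj),
        IsTwoRMBG m H ∧ H.IsRegularOfDegree 256 := by
  classical
  -- A generous threshold: completion needs 72 · 7m + 3 · 256² < 256 · 7m, true once m > 152.
  refine ⟨1000, fun m hm => ?_⟩
  have hk : 2 * m ≤ 5 * m := by omega
  obtain ⟨σ, hσ⟩ := exists_perms_two_mul_card_le_card_biUnion (5 * m)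
  let L := Fin (5 * m) ⊕ Fin (2 * m)
  have hL : Fintype.card L = 7 * m := by
    simp only [L, Fintype.card_sum, Fintype.card_fin]
    ring
  obtain ⟨E, hE, hrow, hcol⟩ := exists_regular_superset (α := L) (β := L) rfl
    {e | foldRel hk σ e.1 e.2} (d₀ := 3 * 24) (d := 256) (by norm_num)
    (fun a => by simpa using card_foldRel_le hk σ a)
    (fun b => by simpa [foldRel_comm hk σ _ b] using card_foldRel_le hk σ b)
    (by rw [hL]; omega)
  have hfold : ∀ a b, foldRel hk σ a b → (a, b) ∈ E := fun a b h => hE (by simpa using h)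
  refine ⟨L ⊕ L, inferInstance, bipartiteGraphOfRel fun a b => (a, b) ∈ E, inferInstance,
    isTwoRMBG_of_expansion (fun S hS => ?_) (fun S hS => ?_), ?_⟩
  · refine (card_le_card_foldRel (by omega) hk hσ S hS).trans (card_le_card fun y hy => ?_)
    simp only [mem_filter, mem_univ, true_and] at hy ⊢
    obtain ⟨a, ha, h⟩ := hy
    exact ⟨a, ha, hfold _ _ h⟩
  · refine (card_le_card_foldRel (by omega) hk hσ S hS).trans (card_le_card fun y hy => ?_)
    simp only [mem_filter, mem_univ, true_and] at hy ⊢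
    obtain ⟨a, ha, h⟩ := hy
    exact ⟨a, ha, hfold _ _ ((foldRel_comm hk σ _ _).1 h)⟩
  · convert bipartiteGraphOfRel_isRegularOfDegree (R := fun a b : L => (a, b) ∈ E) (d := 256)
      (fun a => ?_) (fun b => ?_)
    · rw [← hrow a]
      congr
    · rw [← hcol b]
      congr
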